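/- Let $n,d\ge 1$, let $\mu^\natural_1\neq\mu^\natural_2$ in $\mathbb{R}^d$ (ball centers) and $\mu^0_1\neq\mu^0_2$ in $\mathbb{R}^d$ (initialization) be fixed, and let $\sigma\colon[n]\to[2]$ be balanced, i.e. $|\sigma^{-1}(1)|=|\sigma^{-1}(2)|=n/2$. Put $$\Delta:=\|\mu^\natural_1-\mu^\natural_2\|,\qquad \cos\theta:=\left|\left\langle \frac{\mu^0_1-\mu^0_2}{\|\mu^0_1-\mu^0_2\|},\frac{\mu^\natural_1-\mu^\natural_2}{\|\mu^\natural_1-\mu^\natural_2\|}\right\rangle\right|.$$ Let $x_i=\mu^\natural_{\sigma(i)}+g_i$ for $i\in[n]$, where $g_1,\dots,g_n$ are independent with a common distribution on the closed unit ball of $\mathbb{R}^d$ that is invariant under all orthogonal transformations (the balanced stochastic ball model with $k=2$). A first BalLOT update is any minimizer $F^1$ of $$F\mapsto\sum_{i=1}^n\sum_{j=1}^2F_{ij}\|x_i-\mu^0_j\|^2$$ over all $F\in\mathbb{R}^{n\times2}_{\ge0}$ with $\sum_iF_{ij}=\frac12$ for each $j$ and $\sum_jF_{ij}=\frac1n$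 for each $i$. It determines the assignment $\sigma^1\colon[n]\to[2]$ if $F^1_{ij}=\frac1n$ when $\sigma^1(i)=j$ and $F^1_{ij}=0$ otherwise. (a) If $\Delta\cos\theta\ge2$ (with strict inequality in the case $d=1$), then almost surely BalLOT achieves one-step recovery: a first update exists, and every first update $F^1$ determines an assignment $\pi\circ\sigma$ with $\pi\in S_2$. (b) If $\Delta\cos\theta<2$, then for every $\varepsilon\in(0,1]$, with probability at least $1-\varepsilon$, some first update determines an assignment, and every assignment $\sigma^1$ that is determined by a first update satisfies $$\min_{\pi\in S_2}\frac{|\{i\in[n]:\sigma^1(i)\ne\pi(\sigma(i))\}|}{n}\le\sqrt{\exp\left(-\frac{d-1}{4}(\Delta\cos\theta)^2\right)+\sqrt{\frac1n\log\left(\frac{n}{2\varepsilon}\right)}}.$$ -/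

import Mathlib

open MeasureTheory ProbabilityTheory

namespace BalLOT

noncomputable section

/-- Euclidean space of dimension `d`. -/
abbrev E (d : ℕ) : Type := EuclideanSpace ℝ (Fin d)

/-- The balanced `k`-means objective
`f(F, μ) = ∑ i, ∑ j, F i j * ‖x i - μ j‖ ^ 2`. -/
def objective {n k d : ℕ} (x : Fin n → E d) (F : Matrix (Fin n) (Fin k) ℝ)
    (μ : Fin k → E d) : ℝ :=
  ∑ i, ∑ j, F i j * ‖x i - μ j‖ ^ 2

/-- The transport polytope: nonnegative `n × k` matrices whose column sums are `1 / k` and whose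
row sums are `1 / n`. -/
def couplings (n k : ℕ) : Set (Matrix (Fin n) (Fin k) ℝ) :=
  {F | (∀ i j, 0 ≤ F i j) ∧ (∀ j, ∑ i, F i j = 1 / (k : ℝ)) ∧ (∀ i, ∑ j, F i j = 1 / (n : ℝ))}

/-- `F` is a first BalLOT update from the initialization `μ₀`: a minimizer of `f(·, μ₀)` over
the transport polytope. (It need not be unique for degenerate data.) -/
def IsFirstUpdate {n k d : ℕ} (x : Fin n → E d) (μ₀ : Fin k → E d)
    (F : Matrix (Fin n) (Fin k) ℝ) : Prop :=
  F ∈ couplings n k ∧ IsMinOn (fun G => objective x G μ₀) (couplings n k) F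

/-- The matrix `F` is integral and determines the cluster assignment `τ`:
`F i j = 1 / n` if `i` is assigned to `j`, and `F i j = 0` otherwise. -/
def Determines {n k : ℕ} (F : Matrix (Fin n) (Fin k) ℝ) (τ : Fin n → Fin k) : Prop :=
  ∀ i j, F i j = if τ i = j then 1 / (n : ℝ) else 0

/-- One-step recovery of the planted clustering `σ` (as a partition, that is, up to relabelling
the clusters): a first update exists, and whichever minimizer is taken as the first update,
it is integral and determines the planted clustering. -/
def OneStepRecovery {n k d : ℕ} (x : Fin n → E d) (μ₀ : Fin k → E d)
    (σ : Fin n → Fin k) : Prop :=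
  (∃ F, IsFirstUpdate x μ₀ F) ∧
    ∀ F, IsFirstUpdate x μ₀ F → ∃ π : Equiv.Perm (Fin k), Determines F (fun i => π (σ i))

/-- The misclustering rate of `τ` with respect to `σ`: the minimum over relabellings `π` of the
fraction of indices `i` with `τ i ≠ π (σ i)`. -/
def misclusteringRate {n k : ℕ} (σ τ : Fin n → Fin k) : ℝ :=
  ⨅ π : Equiv.Perm (Fin k), ((Finset.univ.filter fun i => τ i ≠ π (σ i)).card : ℝ) / (n : ℝ)

/-- The assignment `σ` is balanced: all its fibers have the same size. -/
def IsBalanced {n k : ℕ} (σ : Fin n → Fin k) : Prop :=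
  ∀ a b : Fin k, (Finset.univ.filter fun i => σ i = a).card =
    (Finset.univ.filter fun i => σ i = b).card

/-- A rotationally invariant probability distribution over the closed unit ball. -/
structure IsRotationInvariantOnBall {d : ℕ} (ν : Measure (E d)) : Prop where
  prob : IsProbabilityMeasure ν
  invariant : ∀ U : E d ≃ₗᵢ[ℝ] E d, ν.map U = ν
  ball : ∀ᵐ v ∂ν, ‖v‖ ≤ 1

/-- The stochastic ball model: `x i = c (σ i) + g i`, where the `g i` are independent with a
common rotationally invariant distribution over the unit ball. -/
def IsStochasticBallModel {Ω : Type*} [MeasurableSpace Ω] (P : Measure Ω) {n k d : ℕ}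
    (c : Fin k → E d) (σ : Fin n → Fin k) (x : Fin n → Ω → E d) : Prop :=
  ∃ (ν : Measure (E d)) (g : Fin n → Ω → E d),
    IsRotationInvariantOnBall ν ∧ (∀ i, HasLaw (g i) ν P) ∧ iIndepFun g P ∧
      ∀ i ω, x i ω = c (σ i) + g i ω

/-- The absolute cosine similarity between the difference of the two initial centers and the
difference of the two ball centers. -/
def cosSim {d : ℕ} (μ₀ c : Fin 2 → E d) : ℝ :=
  |inner ℝ (‖μ₀ 0 - μ₀ 1‖⁻¹ • (μ₀ 0 - μ₀ 1)) (‖c 0 - c 1‖⁻¹ • (c 0 - c 1))|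

end

end BalLOT

/-!
Call `⟪x i, w⟫` the score of the point `x i`, where `w` is the unit vector along `μ₀ 0 - μ₀ 1`. On
the transport polytope the objective is a constant minus a positive multiple of the total score of
the mass in the first column (`objective_eq`), so a first update puts the `n / 2` largest scores in
the first cluster. After relabelling the clusters, the scores of the two ball centers differ by
`a = Δ cos θ ≥ 0`.

If `a > 2`, or `a = 2` and `d ≥ 2`, the scores of the two balls are almost surely strictly
separated. In the second case equality would need a point at a prescribed place of the unit sphere,
and a rotation invariant distribution has no atom there. A threshold between the two sets of scores
then makes the planted assignment the only minimizer (`oneStepRecovery_of_lt`).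

For general `a ≥ 0`, suppose that a first update misplaces `k` points of the first cluster. It also
misplaces `k` points of the second, and each of the resulting `k ^ 2` pairs is inverted: the point
of the second cluster has a score at least that of the point of the first. The squared
misclustering rate is therefore at most the fraction of inverted pairs. Two facts bound this
fraction.

* A coordinate of the noise is sub-Gaussian with variance proxy `1 / d`
  (`IsRotationInvariantOnBall.hasSubgaussianMGF_inner`). By invariance, its moment generating
  function is unchanged if the direction is averaged over the vectors with all coordinates
  `± 1 / √d`, and the average is a product of hyperbolic cosines, with
  `cosh s ≤ exp (s ^ 2 / 2)`. Hence a given pair is inverted with probability at most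
  `exp (- d * a ^ 2 / 4)`.
* The pairs split into `n / 2` perfect matchings by cyclic shifts. Within a matching the pairs are
  independent, so Hoeffding's inequality applies to each matching, and a union bound over the
  matchings gives the deviation term (`measureReal_sum_inversions_ge_le`).
-/

namespace BalLOT

/-! ### Rotation invariant distributions on the ball -/

section Ball

variable {d : ℕ} {ν : Measure (E d)}

lemma IsRotationInvariantOnBall.map_inner_eq (hν : IsRotationInvariantOnBall ν) {u v : E d}
    (huv : ‖u‖ = ‖v‖) :
    ν.map (fun x => inner ℝ x u) = ν.map (fun x => inner ℝ x v) := by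
  set U : E d ≃ₗᵢ[ℝ] E d := (Submodule.span ℝ {u - v})ᗮ.reflection
  have hU : U u = v := Submodule.reflection_sub huv
  conv_rhs => rw [← hν.invariant U, Measure.map_map (by fun_prop) U.continuous.measurable]
  congr 1
  funext x
  simp only [Function.comp, ← hU, U.inner_map_map]

lemma IsRotationInvariantOnBall.ae_abs_inner_le (hν : IsRotationInvariantOnBall ν) (v : E d) :
    ∀ᵐ x ∂ν, |inner ℝ x v| ≤ ‖v‖ := by
  filter_upwards [hν.ball] with x hx
  exact (abs_real_inner_le_norm x v).trans (mul_le_of_le_one_left (norm_nonneg v) hx)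

lemma IsRotationInvariantOnBall.integrable_exp_inner (hν : IsRotationInvariantOnBall ν) (v : E d)
    (t : ℝ) : Integrable (fun x => Real.exp (t * inner ℝ x v)) ν := by
  have := hν.prob
  refine integrable_exp_mul_of_mem_Icc (a := -‖v‖) (b := ‖v‖) (by fun_prop) ?_
  filter_upwards [hν.ae_abs_inner_le v] with x hx
  exact abs_le.1 hx

/-- The unit vector with coordinates `± 1 / √d`, the signs being given by `z`. -/
noncomputable def signVector (z : Fin d → Bool) : E d :=
  WithLp.toLp 2 fun i => (if z i then 1 else -1) / √(d : ℝ)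

lemma norm_signVector (hd : 0 < d) (z : Fin d → Bool) : ‖signVector z‖ = 1 := by
  have hd' : (0 : ℝ) < d := by exact_mod_cast hd
  have h : ∀ i, (signVector z i) ^ 2 = 1 / (d : ℝ) := by
    intro i
    simp only [signVector, div_pow, Real.sq_sqrt hd'.le]
    split_ifs <;> simp
  rw [EuclideanSpace.norm_eq]
  simp only [Real.norm_eq_abs, sq_abs, h]
  simp [hd'.ne']

/-- Averaging the exponential over the sign vectors factors into hyperbolic cosines. -/
lemma sum_exp_inner_signVector_le (x : E d) (t : ℝ) :
    ∑ z : Fin d → Bool, Real.exp (t * inner ℝ x (signVector z)) ≤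
      2 ^ d * Real.exp (t ^ 2 / (2 * d) * ‖x‖ ^ 2) := by
  have h1 : ∀ z : Fin d → Bool, Real.exp (t * inner ℝ x (signVector z)) =
      ∏ i, Real.exp ((if z i then 1 else -1) * (t * x i / √(d : ℝ))) := by
    intro z
    rw [← Real.exp_sum, PiLp.inner_apply, Finset.mul_sum]
    congr 1
    refine Finset.sum_congr rfl fun i _ => ?_
    simp only [signVector, RCLike.inner_apply, conj_trivial]
    ring
  simp only [h1]
  rw [← Fintype.prod_sum (fun (i : Fin d) (b : Bool) =>
    Real.exp ((if b then 1 else -1) * (t * x i / √(d : ℝ))))]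
  calc ∏ i, ∑ b : Bool, Real.exp ((if b then 1 else -1) * (t * x i / √(d : ℝ)))
      ≤ ∏ i : Fin d, 2 * Real.exp ((t * x i / √(d : ℝ)) ^ 2 / 2) := by
        refine Finset.prod_le_prod (fun i _ => by positivity) fun i _ => ?_
        have := Real.cosh_le_exp_half_sq (t * x i / √(d : ℝ))
        rw [Real.cosh_eq] at this
        simp only [Fintype.sum_bool, if_true, Bool.false_eq_true, if_false, one_mul, neg_one_mul]
        linarith
    _ = 2 ^ d * Real.exp (t ^ 2 / (2 * d) * ‖x‖ ^ 2) := by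
        rw [Finset.prod_mul_distrib, ← Real.exp_sum, EuclideanSpace.norm_sq_eq, Finset.mul_sum]
        simp only [Finset.prod_const, Finset.card_univ, Fintype.card_fin]
        congr 2
        refine Finset.sum_congr rfl fun i _ => ?_
        rw [div_pow, mul_pow, Real.sq_sqrt (Nat.cast_nonneg d), Real.norm_eq_abs, sq_abs]
        ring

/-- A coordinate of a rotation invariant vector in the unit ball is sub-Gaussian with variance
proxy `1 / d`. By invariance its law does not change when the direction is replaced by a random
sign vector `± 1 / √d`, for which the moment generating function is a product of hyperbolic
cosines. -/
lemma IsRotationInvariantOnBall.hasSubgaussianMGF_inner (hν : IsRotationInvariantOnBall ν)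
    (hd : 0 < d) {v : E d} (hv : ‖v‖ = 1) :
    HasSubgaussianMGF (fun x => inner ℝ x v) (1 / (d : NNReal)) ν := by
  have := hν.prob
  refine ⟨hν.integrable_exp_inner v, fun t => ?_⟩
  have h1 : ∀ z : Fin d → Bool,
      mgf (fun x => inner ℝ x v) ν t = ∫ x, Real.exp (t * inner ℝ x (signVector z)) ∂ν := by
    intro z
    rw [mgf, ← integral_map (φ := fun x => inner ℝ x v) (f := fun y => Real.exp (t * y))
      (by fun_prop) (by fun_prop), hν.map_inner_eq (hv.trans (norm_signVector hd z).symm),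
      integral_map (by fun_prop) (by fun_prop)]
  have h2 : (2 : ℝ) ^ d * mgf (fun x => inner ℝ x v) ν t =
      ∫ x, ∑ z : Fin d → Bool, Real.exp (t * inner ℝ x (signVector z)) ∂ν := by
    rw [integral_finsetSum _ fun z _ => hν.integrable_exp_inner _ t]
    simp [← h1]
  have h3 : ∫ x, ∑ z : Fin d → Bool, Real.exp (t * inner ℝ x (signVector z)) ∂ν ≤
      ∫ _x, 2 ^ d * Real.exp (t ^ 2 / (2 * d)) ∂ν := by
    refine integral_mono_ae (integrable_finsetSum _ fun z _ => hν.integrable_exp_inner _ t)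
      (integrable_const _) ?_
    filter_upwards [hν.ball] with x hx
    refine (sum_exp_inner_signVector_le x t).trans ?_
    gcongr
    refine mul_le_of_le_one_right (by positivity) ?_
    exact pow_le_one₀ (norm_nonneg x) hx
  rw [← h2, integral_const, probReal_univ, one_smul] at h3
  refine (le_of_mul_le_mul_left h3 (by positivity)).trans_eq ?_
  congr 1
  push_cast
  field_simp

/-- In dimension at least two a rotation invariant distribution has no atom on the unit sphere:
the infinitely many points of the sphere have equal mass. -/
lemma IsRotationInvariantOnBall.measure_singleton (hν : IsRotationInvariantOnBall ν)
    (hd : 2 ≤ d) {v : E d} (hv : ‖v‖ = 1) : ν {v} = 0 := by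
  have := hν.prob
  by_contra h
  have hrank : 1 < Module.rank ℝ (E d) := by
    rw [← Module.finrank_eq_rank, finrank_euclideanSpace_fin]
    exact_mod_cast hd
  have hinf : (Metric.sphere (0 : E d) 1).Infinite := by
    refine (isPreconnected_sphere hrank 0 1).infinite_of_nontrivial ⟨v, by simpa, -v, by simpa, ?_⟩
    intro hvv
    have : v = 0 := by
      have h2 : (2 : ℝ) • v = 0 := by rw [two_smul, ← sub_neg_eq_add, ← hvv, sub_self]
      simpa using h2
    simp [this] at hv
  refine measure_ne_top ν (Metric.sphere 0 1) (hinf.meas_eq_top ⟨ν {v}, h, fun u hu => ?_⟩)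
  rw [mem_sphere_zero_iff_norm] at hu
  set U : E d ≃ₗᵢ[ℝ] E d := (Submodule.span ℝ {u - v})ᗮ.reflection
  have hU : U u = v := Submodule.reflection_sub (hu.trans hv.symm)
  rw [← hν.invariant U, Measure.map_apply U.continuous.measurable (measurableSet_singleton v),
    hν.invariant U]
  refine measure_mono fun y hy => ?_
  exact U.injective (hy.trans hU.symm)

/-- In dimension at least two, a coordinate does not attain the extreme value `1`. -/
lemma IsRotationInvariantOnBall.ae_inner_lt_one (hν : IsRotationInvariantOnBall ν)
    (hd : 2 ≤ d) {v : E d} (hv : ‖v‖ = 1) : ∀ᵐ x ∂ν, inner ℝ x v < 1 := by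
  have h0 : ∀ᵐ x ∂ν, x ≠ v := by
    rw [ae_iff]
    simpa using hν.measure_singleton hd hv
  filter_upwards [hν.ball, hν.ae_abs_inner_le v, h0] with x hx1 hx2 hx3
  rw [hv] at hx2
  refine lt_of_le_of_ne (abs_le.1 hx2).2 fun h => hx3 ?_
  have h1 : ‖x - v‖ ^ 2 ≤ 0 := by
    rw [norm_sub_sq_real, h, hv]
    nlinarith [norm_nonneg x]
  have h2 : ‖x - v‖ = 0 := by nlinarith [norm_nonneg (x - v)]
  exact sub_eq_zero.1 (norm_eq_zero.1 h2)

end Ball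

/-! ### Independence of disjoint pairs -/

section Pairs

variable {Ω ι κ β : Type*} [MeasurableSpace Ω] [MeasurableSpace β] {P : Measure Ω}

/-- Pairs formed from disjoint pairs of members of an independent family are independent. -/
lemma iIndepFun_prodMk {f : κ → Ω → β} (hf : iIndepFun f P) (hm : ∀ k, Measurable (f k))
    {a b : ι → κ} (hab : (Sum.elim a b).Injective) :
    iIndepFun (fun i ω => (f (a i) ω, f (b i) ω)) P := by
  have hf' := hf.precomp hab
  have hgen : ∀ i, MeasurableSpace.comap (fun ω => (f (a i) ω, f (b i) ω)) inferInstance =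
      MeasurableSpace.generateFrom (Set.preimage (fun ω => (f (a i) ω, f (b i) ω)) ''
        Set.image2 (fun s t => s ×ˢ t) {s : Set β | MeasurableSet s} {t : Set β | MeasurableSet t})
      := by
    intro i
    rw [← MeasurableSpace.comap_generateFrom, generateFrom_prod]
  refine (iIndepFun_iff_iIndep _ _ _).2 (iIndepSets.iIndep (fun i => ?_) _ (fun i => ?_) hgen ?_)
  · exact ((hm _).prodMk (hm _)).comap_le
  · exact isPiSystem_prod.comap _
  · rw [iIndepSets_iff]
    intro S F hF
    have hF' : ∀ i, ∃ A B : Set β, i ∈ S → MeasurableSet A ∧ MeasurableSet B ∧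
        F i = f (a i) ⁻¹' A ∩ f (b i) ⁻¹' B := by
      intro i
      by_cases hi : i ∈ S
      · obtain ⟨_, ⟨A, hA, B, hB, rfl⟩, hAB⟩ := hF i hi
        exact ⟨A, B, fun _ => ⟨hA, hB, hAB.symm⟩⟩
      · exact ⟨∅, ∅, fun h => absurd h hi⟩
    choose A B hAB using hF'
    have key : ∀ T : Finset ι, T ⊆ S → P (⋂ i ∈ T, F i) =
        (∏ i ∈ T, P (f (a i) ⁻¹' A i)) * ∏ i ∈ T, P (f (b i) ⁻¹' B i) := by
      intro T hT
      have h := hf'.measure_inter_preimage_eq_mul (T.disjSum T) (sets := Sum.elim A B) (by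
        rintro (i | i) hi
        · exact (hAB i (hT (by simpa using hi))).1
        · exact (hAB i (hT (by simpa using hi))).2.1)
      rw [Finset.prod_disjSum] at h
      simp only [Sum.elim_inl, Sum.elim_inr] at h
      rw [← h]
      congr 1
      ext ω
      simp only [Set.mem_iInter, Finset.mem_disjSum, Set.mem_preimage]
      constructor
      · rintro hω (i | i) hi
        · have hi' : i ∈ T := by simpa using hi
          have := hω i hi'
          rw [(hAB i (hT hi')).2.2] at this
          exact this.1
        · have hi' : i ∈ T := by simpa using hi
          have := hω i hi'
          rw [(hAB i (hT hi')).2.2] at this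
          exact this.2
      · intro hω i hi
        rw [(hAB i (hT hi)).2.2]
        exact ⟨hω (Sum.inl i) (by simpa using hi), hω (Sum.inr i) (by simpa using hi)⟩
    rw [key S subset_rfl, ← Finset.prod_mul_distrib]
    refine Finset.prod_congr rfl fun i hi => ?_
    have := key {i} (by simpa using hi)
    simpa using this.symm

end Pairs

/-! ### First updates and scores -/

section Deterministic

variable {n d : ℕ}

/-- The unit vector in the direction of the difference of the two initial centers. -/
noncomputable def direction (μ₀ : Fin 2 → E d) : E d := ‖μ₀ 0 - μ₀ 1‖⁻¹ • (μ₀ 0 - μ₀ 1)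

lemma norm_direction {μ₀ : Fin 2 → E d} (hμ₀ : μ₀ 0 ≠ μ₀ 1) : ‖direction μ₀‖ = 1 := by
  rw [direction, norm_smul, norm_inv, norm_norm]
  exact inv_mul_cancel₀ (norm_ne_zero_iff.2 (sub_ne_zero.2 hμ₀))

/-- On the transport polytope the objective is, up to a positive factor and an additive constant,
minus the total score of the mass sent to the first cluster. -/
lemma objective_eq {F : Matrix (Fin n) (Fin 2) ℝ} (hF : F ∈ couplings n 2) (x : Fin n → E d)
    (μ₀ : Fin 2 → E d) :
    objective x F μ₀ =
      (∑ i, 1 / (n : ℝ) * ‖x i - μ₀ 1‖ ^ 2 + 1 / 2 * (‖μ₀ 0‖ ^ 2 - ‖μ₀ 1‖ ^ 2)) -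
        2 * ‖μ₀ 0 - μ₀ 1‖ * ∑ i, F i 0 * inner ℝ (x i) (direction μ₀) := by
  obtain ⟨-, hcol, hrow⟩ := hF
  have hterm : ∀ i, ∑ j, F i j * ‖x i - μ₀ j‖ ^ 2 =
      1 / (n : ℝ) * ‖x i - μ₀ 1‖ ^ 2 + F i 0 * (‖μ₀ 0‖ ^ 2 - ‖μ₀ 1‖ ^ 2) -
        2 * ‖μ₀ 0 - μ₀ 1‖ * (F i 0 * inner ℝ (x i) (direction μ₀)) := by
    intro i
    have hw : ‖μ₀ 0 - μ₀ 1‖ * inner ℝ (x i) (direction μ₀) =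
        inner ℝ (x i) (μ₀ 0) - inner ℝ (x i) (μ₀ 1) := by
      rw [direction, inner_smul_right, ← inner_sub_right, ← mul_assoc]
      by_cases h : ‖μ₀ 0 - μ₀ 1‖ = 0
      · rw [norm_eq_zero] at h
        simp [h]
      · rw [mul_inv_cancel₀ h, one_mul]
    have hr := hrow i
    rw [Fin.sum_univ_two] at hr ⊢
    rw [← hr, norm_sub_sq_real, norm_sub_sq_real]
    linear_combination (2 * F i 0) * hw
  have h0 : ∑ i, F i 0 = 1 / 2 := by simpa using hcol 0
  rw [objective, Finset.sum_congr rfl fun i _ => hterm i, Finset.sum_sub_distrib,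
    Finset.sum_add_distrib, ← Finset.sum_mul, h0, ← Finset.mul_sum Finset.univ (fun i => F i 0 * _)]

lemma isFirstUpdate_iff {μ₀ : Fin 2 → E d} (hμ₀ : μ₀ 0 ≠ μ₀ 1) (x : Fin n → E d)
    (F : Matrix (Fin n) (Fin 2) ℝ) :
    IsFirstUpdate x μ₀ F ↔ F ∈ couplings n 2 ∧ ∀ G ∈ couplings n 2,
      ∑ i, G i 0 * inner ℝ (x i) (direction μ₀) ≤ ∑ i, F i 0 * inner ℝ (x i) (direction μ₀) := by
  have hpos : 0 < 2 * ‖μ₀ 0 - μ₀ 1‖ := by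
    have := norm_pos_iff.2 (sub_ne_zero.2 hμ₀)
    positivity
  refine and_congr_right fun hF => forall₂_congr fun G hG => ?_
  simp only [Set.mem_ofPred_eq, objective_eq hF, objective_eq hG]
  rw [sub_le_sub_iff_left, mul_le_mul_iff_right₀ hpos]

lemma IsBalanced.two_mul_card {σ : Fin n → Fin 2} (hσ : IsBalanced σ) (a : Fin 2) :
    2 * (Finset.univ.filter fun i => σ i = a).card = n := by
  have h := Finset.card_eq_sum_card_fiberwise (f := σ) (s := Finset.univ) (t := Finset.univ)
    (fun _ _ => Finset.mem_coe.2 (Finset.mem_univ _))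
  rw [Finset.card_univ, Fintype.card_fin, Fin.sum_univ_two, hσ 0 a, hσ 1 a] at h
  omega

lemma IsBalanced.comp_left {k : ℕ} {σ : Fin n → Fin k} (hσ : IsBalanced σ)
    (π : Equiv.Perm (Fin k)) : IsBalanced fun i => π (σ i) := by
  intro a b
  simpa only [← Equiv.eq_symm_apply] using hσ (π.symm a) (π.symm b)

lemma IsBalanced.comp_right {k : ℕ} {σ : Fin n → Fin k} (hσ : IsBalanced σ)
    (e : Equiv.Perm (Fin n)) : IsBalanced (σ ∘ e) := by
  have h : ∀ a, (Finset.univ.filter fun i => (σ ∘ e) i = a).card =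
      (Finset.univ.filter fun i => σ i = a).card := fun a =>
    Finset.card_bijective e e.bijective (by simp)
  intro a b
  rw [h, h, hσ a b]

/-- The integral matrix that determines the assignment `τ`. -/
noncomputable def assignmentMatrix {k : ℕ} (τ : Fin n → Fin k) : Matrix (Fin n) (Fin k) ℝ :=
  fun i j => if τ i = j then 1 / (n : ℝ) else 0

lemma determines_iff {k : ℕ} {F : Matrix (Fin n) (Fin k) ℝ} {τ : Fin n → Fin k} :
    Determines F τ ↔ F = assignmentMatrix τ :=
  ⟨fun h => by ext i j; exact h i j, fun h i j => by rw [h]; rfl⟩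

lemma sum_assignmentMatrix_col {k : ℕ} (τ : Fin n → Fin k) (j : Fin k) :
    ∑ i, assignmentMatrix τ i j = (Finset.univ.filter fun i => τ i = j).card / (n : ℝ) := by
  simp [assignmentMatrix, ← Finset.sum_filter, div_eq_mul_inv]

lemma assignmentMatrix_mem_couplings (hn : 0 < n) {τ : Fin n → Fin 2} (hτ : IsBalanced τ) :
    assignmentMatrix τ ∈ couplings n 2 := by
  have hn' : (0 : ℝ) < n := by exact_mod_cast hn
  refine ⟨fun i j => ?_, fun j => ?_, fun i => ?_⟩
  · simp only [assignmentMatrix]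
    split_ifs <;> positivity
  · have h : 2 * ((Finset.univ.filter fun i => τ i = j).card : ℝ) = n := by
      exact_mod_cast hτ.two_mul_card j
    rw [sum_assignmentMatrix_col, Nat.cast_ofNat]
    field_simp
    linarith
  · simp [assignmentMatrix]

lemma isBalanced_of_assignmentMatrix_mem_couplings {k : ℕ} (hn : 0 < n) {τ : Fin n → Fin k}
    (h : assignmentMatrix τ ∈ couplings n k) : IsBalanced τ := by
  have hn' : (n : ℝ) ≠ 0 := by exact_mod_cast hn.ne'
  intro a b
  have hab := (h.2.1 a).trans (h.2.1 b).symm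
  rw [sum_assignmentMatrix_col, sum_assignmentMatrix_col, div_left_inj' hn'] at hab
  exact_mod_cast hab

/-- If exchanging `i` and `j` does not increase the total score of the first cluster, then `i`,
which lies in the first cluster, has a score at least that of `j`, which lies in the second. -/
lemma le_of_sum_comp_swap_le (hn : 0 < n) {τ : Fin n → Fin 2} {y : Fin n → ℝ} {i j : Fin n}
    (hi : τ i = 0) (hj : τ j = 1)
    (h : ∑ r, assignmentMatrix (τ ∘ Equiv.swap i j) r 0 * y r ≤
      ∑ r, assignmentMatrix τ r 0 * y r) : y j ≤ y i := by
  have hn' : (0 : ℝ) < 1 / n := by positivity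
  have hij : i ≠ j := by rintro rfl; simp [hi] at hj
  have h1 : ∑ r, (assignmentMatrix τ r 0 * y r -
      assignmentMatrix (τ ∘ Equiv.swap i j) r 0 * y r) = 1 / n * (y i - y j) := by
    rw [← Finset.sum_subset (Finset.subset_univ {i, j}), Finset.sum_pair hij]
    · simp [assignmentMatrix, hi, hj]
      ring
    · intro r _ hr
      simp only [Finset.mem_insert, Finset.mem_singleton, not_or] at hr
      simp [assignmentMatrix, Equiv.swap_apply_of_ne_of_ne hr.1 hr.2]
  rw [Finset.sum_sub_distrib] at h1
  have h2 : 0 ≤ 1 / (n : ℝ) * (y i - y j) := by linarith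
  exact sub_nonneg.1 (nonneg_of_mul_nonneg_right h2 hn')

/-- Subtracting a threshold `t` from the scores does not change the difference of the total scores
of two couplings. If `t` separates the clusters of `τ`, the terms on the left are nonnegative
(`assignmentMatrix_sub_mul_nonneg`). -/
lemma sum_assignmentMatrix_sub_eq {F : Matrix (Fin n) (Fin 2) ℝ} (hF : F ∈ couplings n 2)
    {τ : Fin n → Fin 2} (hτ : assignmentMatrix τ ∈ couplings n 2) (y : Fin n → ℝ) (t : ℝ) :
    ∑ i, (assignmentMatrix τ i 0 - F i 0) * (y i - t) =
      ∑ i, assignmentMatrix τ i 0 * y i - ∑ i, F i 0 * y i := by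
  have h1 : ∑ i, (assignmentMatrix τ i 0 - F i 0) = 0 := by
    rw [Finset.sum_sub_distrib, hτ.2.1 0, hF.2.1 0, sub_self]
  simp_rw [mul_sub]
  rw [Finset.sum_sub_distrib, ← Finset.sum_mul, h1, zero_mul, sub_zero, ← Finset.sum_sub_distrib]
  exact Finset.sum_congr rfl fun i _ => by ring

lemma assignmentMatrix_sub_mul_nonneg {F : Matrix (Fin n) (Fin 2) ℝ} (hF : F ∈ couplings n 2)
    {τ : Fin n → Fin 2} {y : Fin n → ℝ} {t : ℝ} (h0 : ∀ i, τ i = 0 → t ≤ y i)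
    (h1 : ∀ i, τ i = 1 → y i ≤ t) (i : Fin n) :
    0 ≤ (assignmentMatrix τ i 0 - F i 0) * (y i - t) := by
  have hr := hF.2.2 i
  rw [Fin.sum_univ_two] at hr
  have hF0 := hF.1 i 0
  have hF1 := hF.1 i 1
  obtain h | h : τ i = 0 ∨ τ i = 1 := by omega
  · simp only [assignmentMatrix, h, if_true]
    exact mul_nonneg (by linarith) (sub_nonneg.2 (h0 i h))
  · simp only [assignmentMatrix, h, one_ne_zero, if_false]
    exact mul_nonneg_of_nonpos_of_nonpos (by linarith) (sub_nonpos.2 (h1 i h))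

lemma isFirstUpdate_assignmentMatrix (hn : 0 < n) {μ₀ : Fin 2 → E d} (hμ₀ : μ₀ 0 ≠ μ₀ 1)
    {x : Fin n → E d} {τ : Fin n → Fin 2} (hτ : IsBalanced τ) {t : ℝ}
    (h0 : ∀ i, τ i = 0 → t ≤ inner ℝ (x i) (direction μ₀))
    (h1 : ∀ i, τ i = 1 → inner ℝ (x i) (direction μ₀) ≤ t) :
    IsFirstUpdate x μ₀ (assignmentMatrix τ) := by
  have hmem := assignmentMatrix_mem_couplings hn hτ
  refine (isFirstUpdate_iff hμ₀ x _).2 ⟨hmem, fun G hG => ?_⟩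
  rw [← sub_nonneg, ← sum_assignmentMatrix_sub_eq hG hmem _ t]
  exact Finset.sum_nonneg fun i _ => assignmentMatrix_sub_mul_nonneg hG h0 h1 i

lemma eq_assignmentMatrix_of_isFirstUpdate (hn : 0 < n) {μ₀ : Fin 2 → E d} (hμ₀ : μ₀ 0 ≠ μ₀ 1)
    {x : Fin n → E d} {τ : Fin n → Fin 2} (hτ : IsBalanced τ) {t : ℝ}
    (h0 : ∀ i, τ i = 0 → t < inner ℝ (x i) (direction μ₀))
    (h1 : ∀ i, τ i = 1 → inner ℝ (x i) (direction μ₀) < t)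
    {F : Matrix (Fin n) (Fin 2) ℝ} (hF : IsFirstUpdate x μ₀ F) : F = assignmentMatrix τ := by
  have hmem := assignmentMatrix_mem_couplings hn hτ
  rw [isFirstUpdate_iff hμ₀] at hF
  have hsum := sum_assignmentMatrix_sub_eq hF.1 hmem
    (fun i => inner ℝ (x i) (direction μ₀)) t
  have hnonneg := assignmentMatrix_sub_mul_nonneg hF.1 (fun i hi => (h0 i hi).le)
    (fun i hi => (h1 i hi).le)
  have hzero := (Finset.sum_eq_zero_iff_of_nonneg fun i _ => hnonneg i).1
    (le_antisymm (hsum.trans_le (sub_nonpos.2 (hF.2 _ hmem)))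
      (Finset.sum_nonneg fun i _ => hnonneg i))
  have hcol : ∀ i, F i 0 = assignmentMatrix τ i 0 := by
    intro i
    have hne : inner ℝ (x i) (direction μ₀) - t ≠ 0 := by
      obtain h | h : τ i = 0 ∨ τ i = 1 := by omega
      · exact (sub_pos.2 (h0 i h)).ne'
      · exact (sub_neg.2 (h1 i h)).ne
    exact (sub_eq_zero.1 ((mul_eq_zero.1 (hzero i (Finset.mem_univ i))).resolve_right hne)).symm
  ext i j
  have hr := (hF.1.2.2 i).trans (hmem.2.2 i).symm
  rw [Fin.sum_univ_two, Fin.sum_univ_two, hcol i, add_right_inj] at hr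
  fin_cases j
  · exact hcol i
  · exact hr

lemma le_of_isFirstUpdate_assignmentMatrix (hn : 0 < n) {μ₀ : Fin 2 → E d} (hμ₀ : μ₀ 0 ≠ μ₀ 1)
    {x : Fin n → E d} {τ : Fin n → Fin 2} (h : IsFirstUpdate x μ₀ (assignmentMatrix τ))
    {i j : Fin n} (hi : τ i = 0) (hj : τ j = 1) :
    inner ℝ (x j) (direction μ₀) ≤ inner ℝ (x i) (direction μ₀) := by
  have hτ := isBalanced_of_assignmentMatrix_mem_couplings hn h.1
  exact le_of_sum_comp_swap_le hn (y := fun r => inner ℝ (x r) (direction μ₀)) hi hj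
    (((isFirstUpdate_iff hμ₀ x _).1 h).2 _
      (assignmentMatrix_mem_couplings hn (hτ.comp_right (Equiv.swap i j))))

lemma IsBalanced.exists_eq (hn : 0 < n) {σ : Fin n → Fin 2} (hσ : IsBalanced σ) (a : Fin 2) :
    ∃ i, σ i = a := by
  have h := hσ.two_mul_card a
  obtain ⟨i, hi⟩ := Finset.card_pos.1 (show 0 < (Finset.univ.filter fun i => σ i = a).card by omega)
  exact ⟨i, (Finset.mem_filter.1 hi).2⟩

/-- A balanced assignment of maximal total score determines a first update. -/
lemma exists_isFirstUpdate_assignmentMatrix (hn : 0 < n) {μ₀ : Fin 2 → E d} (hμ₀ : μ₀ 0 ≠ μ₀ 1)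
    (x : Fin n → E d) {σ : Fin n → Fin 2} (hσ : IsBalanced σ) :
    ∃ τ : Fin n → Fin 2, IsFirstUpdate x μ₀ (assignmentMatrix τ) := by
  classical
  obtain ⟨τ, hτ, hmax⟩ := Finset.exists_max_image
    (Finset.univ.filter fun τ : Fin n → Fin 2 => IsBalanced τ)
    (fun τ => ∑ r, assignmentMatrix τ r 0 * inner ℝ (x r) (direction μ₀)) ⟨σ, by simpa⟩
  simp only [Finset.mem_filter, Finset.mem_univ, true_and] at hτ hmax
  obtain ⟨i, hi, hmin⟩ := Finset.exists_min_image (Finset.univ.filter fun i => τ i = 0)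
    (fun i => inner ℝ (x i) (direction μ₀)) (by
      obtain ⟨i, hi⟩ := hτ.exists_eq hn 0
      exact ⟨i, by simpa⟩)
  simp only [Finset.mem_filter, Finset.mem_univ, true_and] at hi hmin
  exact ⟨τ, isFirstUpdate_assignmentMatrix hn hμ₀ hτ hmin fun j hj =>
    le_of_sum_comp_swap_le hn (y := fun r => inner ℝ (x r) (direction μ₀)) hi hj
      (hmax _ (hτ.comp_right _))⟩

/-- Strict separation of the scores of the two clusters makes the first update unique. -/
lemma oneStepRecovery_of_lt (hn : 0 < n) {μ₀ : Fin 2 → E d} (hμ₀ : μ₀ 0 ≠ μ₀ 1)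
    {x : Fin n → E d} {σ : Fin n → Fin 2} (hσ : IsBalanced σ) (π : Equiv.Perm (Fin 2))
    (h : ∀ i j, π (σ i) = 0 → π (σ j) = 1 →
      inner ℝ (x j) (direction μ₀) < inner ℝ (x i) (direction μ₀)) :
    OneStepRecovery x μ₀ σ := by
  have hτ := hσ.comp_left π
  obtain ⟨t, ht1, ht0⟩ : ∃ t : ℝ, (∀ j, π (σ j) = 1 → inner ℝ (x j) (direction μ₀) < t) ∧
      ∀ i, π (σ i) = 0 → t < inner ℝ (x i) (direction μ₀) := by
    obtain ⟨t, ht⟩ := Set.Finite.exists_between'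
      (s := (fun j => inner ℝ (x j) (direction μ₀)) '' {j | π (σ j) = 1})
      (t := (fun i => inner ℝ (x i) (direction μ₀)) '' {i | π (σ i) = 0})
      (Set.toFinite _) (Set.toFinite _) (by
        rintro _ ⟨j, hj, rfl⟩ _ ⟨i, hi, rfl⟩
        exact h i j hi hj)
    exact ⟨t, fun j hj => ht.1 _ ⟨j, hj, rfl⟩, fun i hi => ht.2 _ ⟨i, hi, rfl⟩⟩
  exact ⟨⟨_, isFirstUpdate_assignmentMatrix hn hμ₀ hτ (fun i hi => (ht0 i hi).le)
    fun i hi => (ht1 i hi).le⟩, fun F hF => ⟨π, determines_iff.2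
      (eq_assignmentMatrix_of_isFirstUpdate hn hμ₀ hτ ht0 ht1 hF)⟩⟩

/-- If `τ` sends the largest scores to the first cluster, then each of the points of the first
cluster of `σ` that it misplaces forms an inverted pair with each of the equally many misplaced
points of the second cluster. -/
lemma card_ne_sq_le_card_inversions {σ τ : Fin n → Fin 2} (hσ : IsBalanced σ) (hτ : IsBalanced τ)
    {y : Fin n → ℝ} (hy : ∀ i j, τ i = 0 → τ j = 1 → y j ≤ y i) :
    (Finset.univ.filter fun i => τ i ≠ σ i).card ^ 2 ≤
      4 * (Finset.univ.filter fun p : Fin n × Fin n =>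
        σ p.1 = 0 ∧ σ p.2 = 1 ∧ y p.1 ≤ y p.2).card := by
  set A := Finset.univ.filter fun i => σ i = 0 ∧ τ i = 1
  set B := Finset.univ.filter fun i => σ i = 1 ∧ τ i = 0
  set C := Finset.univ.filter fun i => σ i = 0 ∧ τ i = 0
  have two : ∀ a : Fin 2, a = 0 ∨ a = 1 := by decide
  have hAC : A.card + C.card = (Finset.univ.filter fun i => σ i = 0).card := by
    rw [← Finset.card_union_of_disjoint]
    · congr 1
      ext i
      have := two (τ i)
      simp only [A, C, Finset.mem_union, Finset.mem_filter, Finset.mem_univ, true_and]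
      tauto
    · rw [Finset.disjoint_left]
      intro i
      simp +contextual [A, C]
  have hBC : B.card + C.card = (Finset.univ.filter fun i => τ i = 0).card := by
    rw [← Finset.card_union_of_disjoint]
    · congr 1
      ext i
      have := two (σ i)
      simp only [B, C, Finset.mem_union, Finset.mem_filter, Finset.mem_univ, true_and]
      tauto
    · rw [Finset.disjoint_left]
      intro i
      simp +contextual [B, C]
  have hAB : (Finset.univ.filter fun i => τ i ≠ σ i).card ≤ A.card + B.card := by
    refine (Finset.card_le_card fun i hi => ?_).trans (Finset.card_union_le A B)
    have h1 := two (τ i)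
    have h2 := two (σ i)
    simp only [A, B, Finset.mem_union, Finset.mem_filter, Finset.mem_univ, true_and] at hi ⊢
    rcases h1 with h1 | h1 <;> rcases h2 with h2 | h2 <;> simp_all
  have hprod : A.card * B.card ≤ (Finset.univ.filter fun p : Fin n × Fin n =>
      σ p.1 = 0 ∧ σ p.2 = 1 ∧ y p.1 ≤ y p.2).card := by
    rw [← Finset.card_product]
    refine Finset.card_le_card fun p hp => ?_
    simp only [A, B, Finset.mem_product, Finset.mem_filter, Finset.mem_univ, true_and] at hp ⊢
    exact ⟨hp.1.1, hp.2.1, hy _ _ hp.2.2 hp.1.2⟩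
  have hcard : A.card = B.card := by
    have h1 := hσ.two_mul_card 0
    have h2 := hτ.two_mul_card 0
    omega
  rw [hcard] at hAB hprod
  nlinarith

/-- Splitting the pairs of points from distinct clusters into perfect matchings, one for each
cyclic shift. -/
lemma card_pairs_eq_sum_shifts {m : ℕ} [NeZero m] {σ : Fin n → Fin 2}
    (e₀ : Fin m ≃ {i // σ i = 0}) (e₁ : Fin m ≃ {i // σ i = 1}) (r : Fin n → Fin n → Prop)
    [∀ i j, Decidable (r i j)] :
    ((Finset.univ.filter fun p : Fin n × Fin n => σ p.1 = 0 ∧ σ p.2 = 1 ∧ r p.1 p.2).card : ℝ) =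
      ∑ k : Fin m, ∑ l : Fin m, if r (e₀ l) (e₁ (l + k)) then (1 : ℝ) else 0 := by
  have h1 : ((Finset.univ.filter fun p : Fin n × Fin n =>
      σ p.1 = 0 ∧ σ p.2 = 1 ∧ r p.1 p.2).card : ℝ) =
      ∑ i with σ i = 0, ∑ j with σ j = 1, if r i j then (1 : ℝ) else 0 := by
    rw [Finset.sum_filter, Finset.card_filter, Nat.cast_sum, Fintype.sum_prod_type]
    refine Finset.sum_congr rfl fun i _ => ?_
    rw [Finset.sum_filter]
    split_ifs with hi
    · refine Finset.sum_congr rfl fun j _ => ?_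
      by_cases hj : σ j = 1 <;> by_cases hr : r i j <;> simp [hi, hj, hr]
    · simp [hi]
  rw [h1, Finset.sum_comm (s := (Finset.univ : Finset (Fin m))),
    ← Finset.sum_subtype_eq_sum_filter, Finset.subtype_univ, ← e₀.sum_comp]
  refine Finset.sum_congr rfl fun l _ => ?_
  rw [← Finset.sum_subtype_eq_sum_filter, Finset.subtype_univ, ← e₁.sum_comp,
    ← Equiv.sum_comp (Equiv.addLeft l)]
  rfl

end Deterministic

/-! ### Scores in the stochastic ball model -/

section Model

variable {Ω : Type*} [MeasurableSpace Ω] {P : Measure Ω} {n d : ℕ}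

/-- After relabelling the clusters, the ball centers have ordered scores, and the gap between
their scores is `Δ cos θ`. -/
lemma exists_perm_inner_sub_inner_eq (μ₀ c : Fin 2 → E d) (hc : c 0 ≠ c 1) :
    ∃ π : Equiv.Perm (Fin 2),
      inner ℝ (c (π.symm 0)) (direction μ₀) - inner ℝ (c (π.symm 1)) (direction μ₀) =
        ‖c 0 - c 1‖ * cosSim μ₀ c := by
  have hne : ‖c 0 - c 1‖ ≠ 0 := norm_ne_zero_iff.2 (sub_ne_zero.2 hc)
  have h : ‖c 0 - c 1‖ * cosSim μ₀ c =
      |inner ℝ (c 0) (direction μ₀) - inner ℝ (c 1) (direction μ₀)| := by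
    rw [cosSim, ← direction, inner_smul_right, abs_mul, abs_of_nonneg (by positivity),
      ← mul_assoc, mul_inv_cancel₀ hne, one_mul, real_inner_comm, inner_sub_left]
  rw [h]
  rcases le_total (inner ℝ (c 1) (direction μ₀)) (inner ℝ (c 0) (direction μ₀)) with hle | hle
  · exact ⟨1, by rw [abs_of_nonneg (sub_nonneg.2 hle)]; rfl⟩
  · refine ⟨Equiv.swap 0 1, ?_⟩
    rw [abs_of_nonpos (sub_nonpos.2 hle), neg_sub]
    simp

/-- Points of two balls whose centers have scores `a` apart are in the wrong order exactly when
their noise makes up for `a`; the difference of the two independent noise terms is sub-Gaussian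
with variance proxy `2 / d`. -/
lemma measureReal_inner_sub_ge_le {ν : Measure (E d)} (hν : IsRotationInvariantOnBall ν)
    (hd : 0 < d) {w : E d} (hw : ‖w‖ = 1) {g h : Ω → E d} (hg : HasLaw g ν P) (hh : HasLaw h ν P)
    (hgh : IndepFun g h P) {a : ℝ} (ha : 0 ≤ a) :
    P.real {ω | a ≤ inner ℝ (h ω) w - inner ℝ (g ω) w} ≤ Real.exp (-((d : ℝ) / 4) * a ^ 2) := by
  have hsub := hν.hasSubgaussianMGF_inner hd hw
  have hg' := HasSubgaussianMGF.of_map hg.aemeasurable (hg.map_eq.symm ▸ hsub)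
  have hh' := HasSubgaussianMGF.of_map hh.aemeasurable (hh.map_eq.symm ▸ hsub)
  have hm : Measurable fun x : E d => (inner ℝ x w : ℝ) := by fun_prop
  refine ((hh'.sub_of_indepFun hg' (hgh.symm.comp hm hm)).measure_ge_le ha).trans_eq ?_
  congr 1
  push_cast
  field_simp
  ring

/-- Hoeffding's inequality for independent variables with values in the unit interval. -/
lemma measureReal_sum_ge_le [IsProbabilityMeasure P] {m : ℕ} (hm : 0 < m) {X : Fin m → Ω → ℝ} (hX : iIndepFun X P)
    (hmeas : ∀ i, AEMeasurable (X i) P) (hmem : ∀ i ω, X i ω ∈ Set.Icc 0 1) {q t : ℝ}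
    (hq : ∀ i, ∫ ω, X i ω ∂P ≤ q) (ht : 0 ≤ t) :
    P.real {ω | m * (q + t) ≤ ∑ i, X i ω} ≤ Real.exp (-2 * m * t ^ 2) := by
  have hm' : (0 : ℝ) < m := by exact_mod_cast hm
  have hsub : ∀ i ∈ Finset.univ, HasSubgaussianMGF (fun ω => X i ω - ∫ ω', X i ω' ∂P)
      ((‖(1 : ℝ) - 0‖₊ / 2) ^ 2) P := fun i _ =>
    hasSubgaussianMGF_of_mem_Icc (hmeas i) (ae_of_all _ (hmem i))
  have hind : iIndepFun (fun i ω => X i ω - ∫ ω', X i ω' ∂P) P :=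
    hX.comp (fun i y => y - ∫ ω', X i ω' ∂P) fun i => by fun_prop
  have h := HasSubgaussianMGF.measure_sum_ge_le_of_iIndepFun hind hsub
    (show 0 ≤ m * t by positivity)
  refine (measureReal_mono fun ω hω => ?_).trans (h.trans_eq ?_)
  · simp only [Set.mem_ofPred_eq] at hω ⊢
    have hsum : ∑ i, ∫ ω', X i ω' ∂P ≤ m * q := by
      simpa using Finset.sum_le_sum fun i (_ : i ∈ Finset.univ) => hq i
    rw [Finset.sum_sub_distrib]
    linarith
  · congr 1
    simp
    field_simp

/-- Concentration of the number of inverted pairs: Hoeffding's inequality holds along each of the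
`m` perfect matchings, whose pairs are independent, and a union bound combines them. -/
lemma measureReal_sum_inversions_ge_le [IsProbabilityMeasure P] {ν : Measure (E d)}
    (hν : IsRotationInvariantOnBall ν)
    (hd : 0 < d) {w : E d} (hw : ‖w‖ = 1) {g : Fin n → Ω → E d} (hm : ∀ i, Measurable (g i))
    (hlaw : ∀ i, HasLaw (g i) ν P) (hg : iIndepFun g P) {a : ℝ} (ha : 0 ≤ a) {m : ℕ} [NeZero m]
    {e₀ e₁ : Fin m → Fin n} (he : (Sum.elim e₀ e₁).Injective) {t : ℝ} (ht : 0 ≤ t) :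
    P.real {ω | (m : ℝ) ^ 2 * (Real.exp (-((d : ℝ) / 4) * a ^ 2) + t) ≤
        ∑ k : Fin m, ∑ l : Fin m, if a ≤ inner ℝ (g (e₁ (l + k)) ω) w - inner ℝ (g (e₀ l) ω) w
          then (1 : ℝ) else 0} ≤ m * Real.exp (-2 * m * t ^ 2) := by
  set q := Real.exp (-((d : ℝ) / 4) * a ^ 2)
  set X : Fin m → Fin m → Ω → ℝ := fun k l ω =>
    if a ≤ inner ℝ (g (e₁ (l + k)) ω) w - inner ℝ (g (e₀ l) ω) w then (1 : ℝ) else 0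
  set φ : E d × E d → ℝ := fun p => if a ≤ inner ℝ p.2 w - inner ℝ p.1 w then (1 : ℝ) else 0
  have hφ : Measurable φ := by
    refine Measurable.ite (measurableSet_le measurable_const ?_) measurable_const measurable_const
    fun_prop
  have hshift : ∀ k, (Sum.elim e₀ fun l => e₁ (l + k)).Injective := by
    intro k
    have : (Sum.elim e₀ fun l => e₁ (l + k)) =
        Sum.elim e₀ e₁ ∘ Sum.map id (Equiv.addRight k) := by
      ext (l | l) <;> rfl
    rw [this]
    exact he.comp (Function.injective_id.sumMap (Equiv.addRight k).injective)
  have hX : ∀ k, iIndepFun (X k) P := fun k =>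
    (iIndepFun_prodMk hg hm (hshift k)).comp (fun _ => φ) fun _ => hφ
  have hXm : ∀ k l, Measurable (X k l) := fun k l => hφ.comp ((hm _).prodMk (hm _))
  have hXmem : ∀ k l ω, X k l ω ∈ Set.Icc 0 1 := by
    intro k l ω
    simp only [X]
    split_ifs <;> simp
  have hXq : ∀ k l, ∫ ω, X k l ω ∂P ≤ q := by
    intro k l
    have hS : MeasurableSet {ω | a ≤ inner ℝ (g (e₁ (l + k)) ω) w - inner ℝ (g (e₀ l) ω) w} := by
      refine measurableSet_le measurable_const ?_
      have h0 := hm (e₀ l)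
      have h1 := hm (e₁ (l + k))
      fun_prop
    have hind : X k l = Set.indicator
        {ω | a ≤ inner ℝ (g (e₁ (l + k)) ω) w - inner ℝ (g (e₀ l) ω) w} 1 := by
      ext ω
      simp [X, Set.indicator_apply]
    rw [hind, integral_indicator_one hS]
    refine measureReal_inner_sub_ge_le hν hd hw (hlaw _) (hlaw _) (hg.indepFun fun h => ?_) ha
    exact Sum.inl_ne_inr (hshift k (show Sum.elim e₀ (fun l => e₁ (l + k)) (Sum.inl l) =
      Sum.elim e₀ (fun l => e₁ (l + k)) (Sum.inr l) from h))
  have hsub : {ω | (m : ℝ) ^ 2 * (q + t) ≤ ∑ k, ∑ l, X k l ω} ⊆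
      ⋃ k, {ω | m * (q + t) ≤ ∑ l, X k l ω} := by
    intro ω hω
    by_contra hnot
    simp only [Set.mem_iUnion, Set.mem_ofPred_eq, not_exists, not_le] at hω hnot
    have h := Finset.sum_lt_sum_of_nonempty (s := Finset.univ) Finset.univ_nonempty
      fun k _ => hnot k
    simp only [Finset.sum_const, Finset.card_univ, Fintype.card_fin, nsmul_eq_mul] at h
    nlinarith
  calc P.real {ω | (m : ℝ) ^ 2 * (q + t) ≤ ∑ k, ∑ l, X k l ω}
      ≤ P.real (⋃ k, {ω | m * (q + t) ≤ ∑ l, X k l ω}) := measureReal_mono hsub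
    _ ≤ ∑ k, P.real {ω | m * (q + t) ≤ ∑ l, X k l ω} := measureReal_iUnion_fintype_le _
    _ ≤ ∑ _k : Fin m, Real.exp (-2 * m * t ^ 2) := Finset.sum_le_sum fun k _ =>
        measureReal_sum_ge_le (NeZero.pos m) (hX k) (fun l => (hXm k l).aemeasurable) (hXmem k)
          (hXq k) ht
    _ = m * Real.exp (-2 * m * t ^ 2) := by simp

/-- At gap at least two the scores of the two balls are almost surely strictly separated. Equality
would need a point at the extreme of its ball, which has probability zero unless `d = 1`. -/
lemma ae_inner_sub_inner_lt {ν : Measure (E d)} (hν : IsRotationInvariantOnBall ν)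
    (hd : 0 < d) {w : E d} (hw : ‖w‖ = 1) {g : Fin n → Ω → E d}
    (hlaw : ∀ i, HasLaw (g i) ν P) {a : ℝ} (ha : 2 ≤ a) (ha' : d = 1 → 2 < a) :
    ∀ᵐ ω ∂P, ∀ i j, inner ℝ (g j ω) w - inner ℝ (g i ω) w < a := by
  have hpull : ∀ p : E d → Prop, (∀ᵐ v ∂ν, p v) → ∀ᵐ ω ∂P, ∀ i, p (g i ω) := fun p hp =>
    ae_all_iff.2 fun i => ae_of_ae_map (hlaw i).aemeasurable ((hlaw i).map_eq.symm ▸ hp)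
  have hle := hpull _ (hν.ae_abs_inner_le w)
  simp only [hw, abs_le] at hle
  rcases eq_or_ne d 1 with h1 | h1
  · filter_upwards [hle] with ω hω i j
    linarith [(hω i).1, (hω j).2, ha' h1]
  · filter_upwards [hle, hpull _ (hν.ae_inner_lt_one (by omega) hw)] with ω hω hlt i j
    linarith [(hω i).1, hlt j]

/-- A bound on the number of inverted pairs bounds the misclustering rate of every assignment
determined by a first update. -/
lemma misclusteringRate_le_sqrt {m : ℕ} (hm : 0 < m) (hnm : n = 2 * m) {μ₀ : Fin 2 → E d}
    (hμ₀ : μ₀ 0 ≠ μ₀ 1) {x : Fin n → E d} {σ τ : Fin n → Fin 2} (hσ : IsBalanced σ)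
    (π : Equiv.Perm (Fin 2)) {b : ℝ}
    (hinv : ((Finset.univ.filter fun p : Fin n × Fin n => π (σ p.1) = 0 ∧ π (σ p.2) = 1 ∧
      inner ℝ (x p.1) (direction μ₀) ≤ inner ℝ (x p.2) (direction μ₀)).card : ℝ) ≤ (m : ℝ) ^ 2 * b)
    (h : IsFirstUpdate x μ₀ (assignmentMatrix τ)) : misclusteringRate σ τ ≤ √b := by
  have hn : 0 < n := by omega
  have hm' : (0 : ℝ) < m := by exact_mod_cast hm
  have hτ := isBalanced_of_assignmentMatrix_mem_couplings hn h.1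
  have hcard := card_ne_sq_le_card_inversions (hσ.comp_left π) hτ
    (y := fun i => inner ℝ (x i) (direction μ₀))
    fun i j => le_of_isFirstUpdate_assignmentMatrix hn hμ₀ h
  have hcard' := (Nat.cast_le (α := ℝ)).2 hcard
  push_cast at hcard'
  refine (ciInf_le (Set.finite_range _).bddBelow π).trans (Real.le_sqrt_of_sq_le ?_)
  have hnm' : (n : ℝ) = 2 * m := by exact_mod_cast hnm
  rw [div_pow, div_le_iff₀ (by positivity), show (n : ℝ) ^ 2 = (2 * m) ^ 2 by rw [hnm']]
  linarith

end Model

end BalLOT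

/-! ### Recovery after one update -/

theorem theorem4 {Ω : Type*} [MeasurableSpace Ω] (P : Measure Ω) [IsProbabilityMeasure P]
    (n d : ℕ) (hn : 0 < n)
    (c μ₀ : Fin 2 → BalLOT.E d) (hc : c 0 ≠ c 1) (hμ₀ : μ₀ 0 ≠ μ₀ 1)
    (σ : Fin n → Fin 2) (hσ : BalLOT.IsBalanced σ)
    (x : Fin n → Ω → BalLOT.E d) (hx : BalLOT.IsStochasticBallModel P c σ x)
    (Δ cosθ : ℝ) (hΔ : Δ = ‖c 0 - c 1‖) (hcosθ : cosθ = BalLOT.cosSim μ₀ c) :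
    (2 ≤ Δ * cosθ → (d = 1 → 2 < Δ * cosθ) →
      ∀ᵐ ω ∂P, BalLOT.OneStepRecovery (fun i => x i ω) μ₀ σ) ∧
    (Δ * cosθ < 2 → ∀ ε : ℝ, 0 < ε → ε ≤ 1 →
      1 - ε ≤ P.real {ω |
        (∃ F σ₁, BalLOT.IsFirstUpdate (fun i => x i ω) μ₀ F ∧ BalLOT.Determines F σ₁) ∧
        ∀ F σ₁, BalLOT.IsFirstUpdate (fun i => x i ω) μ₀ F → BalLOT.Determines F σ₁ →
          BalLOT.misclusteringRate σ σ₁ ≤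
            √(Real.exp (-(((d : ℝ) - 1) / 4) * (Δ * cosθ) ^ 2)
              + √(1 / (n : ℝ) * Real.log ((n : ℝ) / (2 * ε))))}) := by
  obtain ⟨ν, g, hν, hlaw, hg, hxg⟩ := hx
  have hd : 0 < d := by
    rcases Nat.eq_zero_or_pos d with rfl | h
    · exact absurd (Subsingleton.elim _ _) hc
    · exact h
  have hw := BalLOT.norm_direction hμ₀
  obtain ⟨π, hπ⟩ := BalLOT.exists_perm_inner_sub_inner_eq μ₀ c hc
  rw [← hΔ, ← hcosθ] at hπ
  have ha0 : 0 ≤ Δ * cosθ := by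
    rw [hΔ, hcosθ]
    exact mul_nonneg (norm_nonneg _) (abs_nonneg _)
  set a := Δ * cosθ
  set w := BalLOT.direction μ₀
  -- The order of two scores from distinct clusters depends only on the noise and on the gap `a`.
  have hscore : ∀ ω i j, π (σ i) = 0 → π (σ j) = 1 →
      inner ℝ (x i ω) w - inner ℝ (x j ω) w =
        a - (inner ℝ (g j ω) w - inner ℝ (g i ω) w) := by
    intro ω i j hi hj
    rw [hxg, hxg, π.eq_symm_apply.2 hi, π.eq_symm_apply.2 hj, inner_add_left, inner_add_left, ← hπ]
    ring
  constructor
  · intro ha ha'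
    filter_upwards [BalLOT.ae_inner_sub_inner_lt hν hd hw hlaw ha ha'] with ω hω
    refine BalLOT.oneStepRecovery_of_lt hn hμ₀ hσ π fun i j hi hj => ?_
    have h1 := hscore ω i j hi hj
    have h2 := hω i j
    exact sub_pos.1 (by rw [h1]; linarith)
  · intro _ ε hε hε1
    have hσ' := hσ.comp_left π
    obtain ⟨m, hm⟩ : ∃ m, m = (Finset.univ.filter fun i => π (σ i) = 0).card := ⟨_, rfl⟩
    have hnm : n = 2 * m := by rw [hm]; exact (hσ'.two_mul_card 0).symm
    have hm0 : 0 < m := by omega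
    have : NeZero m := ⟨hm0.ne'⟩
    have e₀ : Fin m ≃ {i // π (σ i) = 0} :=
      (Fintype.equivFinOfCardEq (by rw [Fintype.card_subtype, hm])).symm
    have e₁ : Fin m ≃ {i // π (σ i) = 1} :=
      (Fintype.equivFinOfCardEq (by rw [Fintype.card_subtype, hm, hσ' 1 0])).symm
    have he : (Sum.elim (fun l => (e₀ l : Fin n)) fun l => (e₁ l : Fin n)).Injective := by
      refine (Subtype.val_injective.comp e₀.injective).sumElim
        (Subtype.val_injective.comp e₁.injective) fun k l hkl => ?_
      have h0 := (e₀ k).2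
      have h1 := (e₁ l).2
      simp only [Function.comp] at hkl
      rw [hkl, h1] at h0
      exact one_ne_zero h0
    -- A measurable modification of the noise.
    set g' : Fin n → Ω → BalLOT.E d := fun i => (hlaw i).aemeasurable.mk (g i)
    have hgg' : ∀ i, g i =ᵐ[P] g' i := fun i => (hlaw i).aemeasurable.ae_eq_mk
    set t := √(1 / (n : ℝ) * Real.log ((n : ℝ) / (2 * ε)))
    have hn1 : 1 ≤ (n : ℝ) / (2 * ε) := by
      have : (2 : ℝ) ≤ n := by exact_mod_cast (by omega : 2 ≤ n)
      rw [le_div_iff₀ (by positivity)]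
      linarith
    have hbad := BalLOT.measureReal_sum_inversions_ge_le hν hd hw
      (fun i => (hlaw i).aemeasurable.measurable_mk)
      (fun i => (hlaw i).congr (hgg' i).symm) (hg.congr hgg') ha0 he (Real.sqrt_nonneg _ : 0 ≤ t)
    set q := Real.exp (-((d : ℝ) / 4) * a ^ 2)
    -- The deviation `t` makes each matching fail with probability `2 * ε / n`.
    have hε' : m * Real.exp (-2 * m * t ^ 2) = ε := by
      have hnm' : (n : ℝ) = 2 * m := by exact_mod_cast hnm
      have hm' : (0 : ℝ) < m := by exact_mod_cast hm0
      have hexp : -2 * m * t ^ 2 = -Real.log ((n : ℝ) / (2 * ε)) := by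
        rw [Real.sq_sqrt (mul_nonneg (by positivity) (Real.log_nonneg hn1)), hnm']
        field_simp
      rw [hexp, Real.exp_neg, Real.exp_log (by linarith), hnm']
      field_simp
    rw [hε'] at hbad
    refine (sub_le_sub_left hbad 1).trans ?_
    rw [sub_le_iff_le_add']
    set B : Set Ω := {ω | (m : ℝ) ^ 2 * (q + t) ≤ ∑ k : Fin m, ∑ l : Fin m,
      if a ≤ inner ℝ (g' (e₁ (l + k)) ω) w - inner ℝ (g' (e₀ l) ω) w then (1 : ℝ) else 0}
    have hgood : ∀ ω, (∀ i, g i ω = g' i ω) → ω ∉ B →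
        (∃ F σ₁, BalLOT.IsFirstUpdate (fun i => x i ω) μ₀ F ∧ BalLOT.Determines F σ₁) ∧
        ∀ F σ₁, BalLOT.IsFirstUpdate (fun i => x i ω) μ₀ F → BalLOT.Determines F σ₁ →
          BalLOT.misclusteringRate σ σ₁ ≤ √(Real.exp (-(((d : ℝ) - 1) / 4) * a ^ 2) + t) := by
      intro ω hω hB
      constructor
      · obtain ⟨τ, hτ⟩ :=
          BalLOT.exists_isFirstUpdate_assignmentMatrix hn hμ₀ (fun i => x i ω) hσ
        exact ⟨_, τ, hτ, BalLOT.determines_iff.2 rfl⟩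
      · intro F τ hF hdet
        rw [BalLOT.determines_iff.1 hdet] at hF
        have hqle : q ≤ Real.exp (-(((d : ℝ) - 1) / 4) * a ^ 2) := by
          refine Real.exp_le_exp.2 (mul_le_mul_of_nonneg_right ?_ (sq_nonneg a))
          linarith
        refine (BalLOT.misclusteringRate_le_sqrt hm0 hnm hμ₀ hσ π ?_ hF).trans
          (Real.sqrt_le_sqrt (add_le_add_left hqle t))
        rw [BalLOT.card_pairs_eq_sum_shifts (σ := fun i => π (σ i)) e₀ e₁
          (fun i j => inner ℝ (x i ω) w ≤ inner ℝ (x j ω) w)]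
        refine le_trans (le_of_eq ?_) (not_le.1 hB).le
        refine Finset.sum_congr rfl fun k _ => Finset.sum_congr rfl fun l _ => ?_
        have h1 := hscore ω _ _ (e₀ l).2 (e₁ (l + k)).2
        rw [← hω, ← hω]
        congr 1
        rw [← sub_nonpos, h1, sub_nonpos]
    calc (1 : ℝ) = P.real Set.univ := probReal_univ.symm
      _ ≤ P.real (B ∪ _) := by
        refine ENNReal.toReal_mono (measure_ne_top P _) (measure_mono_ae ?_)
        filter_upwards [ae_all_iff.2 hgg'] with ω hω _
        by_cases hB : ω ∈ B
        · exact Or.inl hB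
        · exact Or.inr (hgood ω hω hB)
      _ ≤ P.real B + P.real _ := measureReal_union_le _ _
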